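/- Let $(M,g)$ be a Riemannian manifold, let $(N,J,h)$ be a Kähler manifold, and let $\varphi : M \to N$ be a smooth map. Then the following are equivalent: (1) $\varphi$ pulls back local real pluriharmonic functions on $N$ to local harmonic functions on $M$: for every open set $V \subseteq N$ and every smooth function $f : V \to \mathbb{R}$ satisfying $\dfrac{\partial^2 f}{\partial z^\alpha\,\partial \bar z^\beta} = 0$ for all $\alpha,\beta$ in local holomorphic coordinates $(z^\alpha)$, the function $f \circ \varphi$ is harmonic (its Laplacian with respect to $g$ vanishes) on the open set $\varphi^{-1}(V) \subseteq M$; (2) $\varphi$ is a pseudo harmonic morphism: $\varphi$ is a harmonic map (its tension field $\operatorname{trace}_g \nabla d\varphi$ vanishes) and it satisfies $$[\,d\varphi_x \circ (d\varphi_x)^{*},\, J\,] = 0 \quad\text{on } T_{\varphi(x)}N \text{ for every } x \in M, \tag{PHWC}$$ where $(d\varphi_x)^{*} : T_{\varphi(x)}N \to T_xM$ is the adjoint of $d\varphi_x$ with respect to $g$ and $h$. -/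

import Mathlib

open Bundle
open scoped Manifold ContDiff

noncomputable section

/-! ### Complex manifolds and their real tangent spaces -/

section ComplexManifold

variable {E' : Type*} [NormedAddCommGroup E'] [NormedSpace ℂ E']
  {N : Type*} [TopologicalSpace N] [ChartedSpace E' N]

/-- The real-analytic (hence smooth) manifold underlying a complex manifold: the charts are the
same, and the transition maps, being holomorphic, are real-analytic. -/
instance isManifold_real_of_complex [IsManifold 𝓘(ℂ, E') ω N] : IsManifold 𝓘(ℝ, E') ω N := by
  refine isManifold_of_contDiffOn 𝓘(ℝ, E') ω N fun e e' he he' => ?_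
  have h := (contDiffGroupoid ω 𝓘(ℂ, E')).compatible he he'
  rw [contDiffGroupoid, mem_groupoid_of_pregroupoid] at h
  have h1 : ContDiffOn ℂ ω (𝓘(ℂ, E') ∘ (e.symm ≫ₕ e') ∘ 𝓘(ℂ, E').symm)
    (𝓘(ℂ, E').symm ⁻¹' (e.symm ≫ₕ e').source ∩ Set.range 𝓘(ℂ, E')) := h.1
  exact h1.restrict_scalars ℝ

/-- The almost complex structure `J` on `T_y N`. The tangent space at `y` is the model space `E'`,
read through the preferred chart at `y`; as the charts are holomorphic, `J` is multiplication
by `i` there. -/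
def almostComplexJ (y : N) : TangentSpace 𝓘(ℝ, E') y →ₗ[ℝ] TangentSpace 𝓘(ℝ, E') y :=
  ((LinearMap.lsmul ℂ E' Complex.I).restrictScalars ℝ : E' →ₗ[ℝ] E')

end ComplexManifold

/-! ### Local Riemannian geometry in charts -/

section Riemannian

variable {E : Type*} [NormedAddCommGroup E] [NormedSpace ℝ E]
  {M : Type*} [TopologicalSpace M] [ChartedSpace E M]
  [RiemannianBundle (fun x : M => TangentSpace 𝓘(ℝ, E) x)]

instance finiteDimensional_tangentSpace [FiniteDimensional ℝ E] (x : M) :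
    FiniteDimensional ℝ (TangentSpace 𝓘(ℝ, E) x) :=
  inferInstanceAs (FiniteDimensional ℝ E)

/-- The Riemannian metric in the chart at `x₀`: the pull-back of the metric by the inverse of the
chart, evaluated at the point `p` on the vectors `u` and `v`. -/
def chartMetric (x₀ : M) (p u v : E) : ℝ :=
  inner ℝ
    (mfderiv 𝓘(ℝ, E) 𝓘(ℝ, E) (extChartAt 𝓘(ℝ, E) x₀).symm p u)
    (mfderiv 𝓘(ℝ, E) 𝓘(ℝ, E) (extChartAt 𝓘(ℝ, E) x₀).symm p v)

variable [FiniteDimensional ℝ E]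

/-- The inverse `(g^{ij})` of the matrix `(g_{ij})` of the metric at the point `p` of the chart at
`x₀`, in the linear coordinates of the model space given by the basis `Module.finBasis ℝ E`. -/
def chartMetricInv (x₀ : M) (p : E) :
    Matrix (Fin (Module.finrank ℝ E)) (Fin (Module.finrank ℝ E)) ℝ :=
  (Matrix.of fun i j =>
    chartMetric x₀ p (Module.finBasis ℝ E i) (Module.finBasis ℝ E j))⁻¹

/-- The Christoffel symbols of the Levi-Civita connection in the chart at `x₀`, as a vector:
`Γ(u, v) = ∑ₖₗ g^{kl} · ½ (∂ᵤ g(v, bₗ) + ∂ᵥ g(u, bₗ) - ∂_{bₗ} g(u, v)) · bₖ`. -/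
def christoffel (x₀ : M) (p u v : E) : E :=
  ∑ k, ∑ l, (chartMetricInv x₀ p k l * ((1 / 2 : ℝ) *
    (fderiv ℝ (fun q => chartMetric x₀ q v (Module.finBasis ℝ E l)) p u
      + fderiv ℝ (fun q => chartMetric x₀ q u (Module.finBasis ℝ E l)) p v
      - fderiv ℝ (fun q => chartMetric x₀ q u v) p (Module.finBasis ℝ E l)))) •
    Module.finBasis ℝ E k

/-- The Laplace-Beltrami operator `∑ᵢⱼ g^{ij} (∂ᵢ∂ⱼ f - Γᵏᵢⱼ ∂ₖ f)` at the point `x`, computed in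
the chart at `x`. It depends only on the germ of `f` at `x`. -/
def laplaceBeltrami (f : M → ℝ) (x : M) : ℝ :=
  let p : E := extChartAt 𝓘(ℝ, E) x x
  let F : E → ℝ := f ∘ (extChartAt 𝓘(ℝ, E) x).symm
  ∑ i, ∑ j, chartMetricInv x p i j *
    (fderiv ℝ (fderiv ℝ F) p (Module.finBasis ℝ E i) (Module.finBasis ℝ E j)
      - fderiv ℝ F p (christoffel x p (Module.finBasis ℝ E i) (Module.finBasis ℝ E j)))

variable (E) in
/-- `f` is a harmonic function on the set `U` (meant to be open): it is smooth there and its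
Laplacian vanishes. -/
structure IsHarmonicFunctionOn (f : M → ℝ) (U : Set M) : Prop where
  contMDiffOn : ContMDiffOn 𝓘(ℝ, E) 𝓘(ℝ, ℝ) ∞ f U
  laplaceBeltrami_eq_zero : ∀ x ∈ U, laplaceBeltrami (E := E) f x = 0

variable {F : Type*} [NormedAddCommGroup F] [NormedSpace ℝ F] [FiniteDimensional ℝ F]
  {N : Type*} [TopologicalSpace N] [ChartedSpace F N]
  [RiemannianBundle (fun y : N => TangentSpace 𝓘(ℝ, F) y)]

/-- The tension field `τ(φ) = trace ∇dφ` at the point `x`, computed in the charts at `x` and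
`φ x`, in which its components are
`∑ᵢⱼ g^{ij} (∂ᵢ∂ⱼ φᶜ - ᴹΓᵏᵢⱼ ∂ₖ φᶜ + ᴺΓᶜₐᵦ ∂ᵢφᵃ ∂ⱼφᵇ)`. -/
def tensionField (φ : M → N) (x : M) : TangentSpace 𝓘(ℝ, F) (φ x) :=
  let p : E := extChartAt 𝓘(ℝ, E) x x
  let q : F := extChartAt 𝓘(ℝ, F) (φ x) (φ x)
  let ψ : E → F := extChartAt 𝓘(ℝ, F) (φ x) ∘ φ ∘ (extChartAt 𝓘(ℝ, E) x).symm
  (∑ i, ∑ j, chartMetricInv x p i j •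
    (fderiv ℝ (fderiv ℝ ψ) p (Module.finBasis ℝ E i) (Module.finBasis ℝ E j)
      - fderiv ℝ ψ p (christoffel x p (Module.finBasis ℝ E i) (Module.finBasis ℝ E j))
      + christoffel (φ x) q (fderiv ℝ ψ p (Module.finBasis ℝ E i))
          (fderiv ℝ ψ p (Module.finBasis ℝ E j))) : F)

variable (E F) in
/-- Harmonic maps between Riemannian manifolds: smooth maps with vanishing tension field. -/
structure IsHarmonicMap (φ : M → N) : Prop where
  contMDiff : ContMDiff 𝓘(ℝ, E) 𝓘(ℝ, F) ∞ φ
  tensionField_eq_zero : ∀ x, tensionField (E := E) (F := F) φ x = 0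

end Riemannian

/-! ### Kähler manifolds, pluriharmonic functions and pseudo harmonic morphisms -/

section Kahler

variable {E' : Type*} [NormedAddCommGroup E'] [NormedSpace ℂ E']
  {N : Type*} [TopologicalSpace N] [ChartedSpace E' N]

section Metric

variable [RiemannianBundle (fun y : N => TangentSpace 𝓘(ℝ, E') y)]

/-- The fundamental two-form `Ω(X, Y) = h(JX, Y)` in the chart at `y₀`: its pull-back by the
inverse of the chart, evaluated at the point `p` on the vectors `u` and `v`. -/
def chartKahlerForm (y₀ : N) (p u v : E') : ℝ :=
  inner ℝ
    (almostComplexJ ((extChartAt 𝓘(ℝ, E') y₀).symm p)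
      (mfderiv 𝓘(ℝ, E') 𝓘(ℝ, E') (extChartAt 𝓘(ℝ, E') y₀).symm p u))
    (mfderiv 𝓘(ℝ, E') 𝓘(ℝ, E') (extChartAt 𝓘(ℝ, E') y₀).symm p v)

variable (E' N) in
/-- The Riemannian metric of `N` is Kähler: it is Hermitian and its fundamental two-form is closed.
The exterior derivative at `y` is computed in the chart at `y`, on constant vector fields. -/
structure IsKahlerMetric : Prop where
  hermitian : ∀ (y : N) (u v : TangentSpace 𝓘(ℝ, E') y),
    inner ℝ (almostComplexJ y u) (almostComplexJ y v) = inner ℝ u v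
  closed : ∀ (y : N) (u v w : E'),
    fderiv ℝ (fun p => chartKahlerForm y p v w) (extChartAt 𝓘(ℝ, E') y y) u
      + fderiv ℝ (fun p => chartKahlerForm y p w u) (extChartAt 𝓘(ℝ, E') y y) v
      + fderiv ℝ (fun p => chartKahlerForm y p u v) (extChartAt 𝓘(ℝ, E') y y) w = 0

end Metric

/-- The derivative of `G` along the `(1,0)`-vector `½ (v - i J v)`. If `v` is the `α`-th vector of
a complex basis, this is `∂G / ∂z^α` for the corresponding linear coordinates. -/
def wirtinger (G : E' → ℂ) (v p : E') : ℂ :=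
  (1 / 2 : ℂ) * (fderiv ℝ G p v - Complex.I * fderiv ℝ G p (Complex.I • v))

/-- The derivative of `G` along the `(0,1)`-vector `½ (v + i J v)`. If `v` is the `β`-th vector of
a complex basis, this is `∂G / ∂z̄^β` for the corresponding linear coordinates. -/
def wirtingerBar (G : E' → ℂ) (v p : E') : ℂ :=
  (1 / 2 : ℂ) * (fderiv ℝ G p v + Complex.I * fderiv ℝ G p (Complex.I • v))

variable (E') in
/-- `f` is a real pluriharmonic function on the set `V` (meant to be open): it is smooth there and
`∂² f / ∂z^α ∂z̄^β = 0` for all `α` and `β` at every `y ∈ V`, in the holomorphic coordinates given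
by the chart at `y`. -/
structure IsPluriharmonicOn (f : N → ℝ) (V : Set N) : Prop where
  contMDiffOn : ContMDiffOn 𝓘(ℝ, E') 𝓘(ℝ, ℝ) ∞ f V
  wirtinger_wirtingerBar_eq_zero : ∀ y ∈ V, ∀ v w : E',
    wirtinger
      (wirtingerBar (fun p : E' => ((f ((extChartAt 𝓘(ℝ, E') y).symm p) : ℝ) : ℂ)) w)
      v (extChartAt 𝓘(ℝ, E') y y) = 0

end Kahler

section PseudoHarmonicMorphism

variable {E : Type*} [NormedAddCommGroup E] [NormedSpace ℝ E] [FiniteDimensional ℝ E]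
  {M : Type*} [TopologicalSpace M] [ChartedSpace E M]
  [RiemannianBundle (fun x : M => TangentSpace 𝓘(ℝ, E) x)]
  {E' : Type*} [NormedAddCommGroup E'] [NormedSpace ℂ E'] [FiniteDimensional ℂ E']
  {N : Type*} [TopologicalSpace N] [ChartedSpace E' N]
  [RiemannianBundle (fun y : N => TangentSpace 𝓘(ℝ, E') y)]

variable (E E') in
/-- Pseudo horizontal weak conformality: `[dφ ∘ (dφ)*, J] = 0` on `T_{φ(x)} N` for every `x`, where
`(dφ)*` is the adjoint with respect to the two Riemannian metrics. -/
def IsPHWC (φ : M → N) : Prop :=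
  ∀ x : M,
    let dφ : TangentSpace 𝓘(ℝ, E) x →ₗ[ℝ] TangentSpace 𝓘(ℝ, E') (φ x) :=
      (mfderiv 𝓘(ℝ, E) 𝓘(ℝ, E') φ x).toLinearMap
    (dφ ∘ₗ LinearMap.adjoint dφ) ∘ₗ almostComplexJ (φ x)
      = almostComplexJ (φ x) ∘ₗ (dφ ∘ₗ LinearMap.adjoint dφ)

variable (E E') in
/-- A pseudo harmonic morphism is a harmonic map which is pseudo horizontally weakly conformal. -/
structure IsPseudoHarmonicMorphism (φ : M → N) : Prop where
  isHarmonicMap : IsHarmonicMap E E' φ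
  isPHWC : IsPHWC E E' φ

end PseudoHarmonicMorphism

end

/-! ### Linear algebra -/

section LinearAlgebra

/-! Everything is pointwise and rests on the composition formula `laplaceBeltrami_comp`: Δ(f ∘ φ) =
df(τ(φ)) + tr (∇df)(dφ, dφ). The trace pairs the covariant Hessian of f with the bivector ∑ g^{ij}
∂ᵢφ ⊗ ∂ⱼφ, which represents dφ ∘ dφ*. Since J is orthogonal with J² = -1, PHWC says exactly that
this bivector is J-invariant (`isPHWC_iff`).

If f is pluriharmonic, its coordinate Hessian is J-anti-invariant; so is the Christoffel term of a
Kähler metric (`IsKahlerMetric.christoffel_I_smul`), hence so is ∇df. An anti-invariant form pairs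
to zero with an invariant bivector, so under PHWC Δ(f ∘ φ) = df(τ(φ)), which vanishes when φ is
harmonic.

Conversely, real parts of holomorphic functions of the coordinates are test functions. A product of
two complex-linear functionals centred at φ(x) has no first derivative there, so only its Hessian
survives, and this forces invariance of the bivector. Then Δ(f ∘ φ) = df(τ(φ)) is available, and the
real parts of linear functionals force τ(φ) = 0. -/

/-- Pairing with the basis multiplies coordinates by the Gram matrix, so its inverse recovers them.
This turns adjoints into the g^{ij}-sums of the Laplacian. -/
theorem inner_eq_sum_gram_inv {ι V : Type*} [Fintype ι] [DecidableEq ι] [NormedAddCommGroup V]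
    [InnerProductSpace ℝ V] (b : Module.Basis ι ℝ V) (X Y : V) :
    inner ℝ X Y = ∑ i, ∑ j, (Matrix.gram ℝ b)⁻¹ i j * (inner ℝ X (b i) * inner ℝ Y (b j)) := by
  have hdet : IsUnit (Matrix.gram ℝ b).det :=
    (Matrix.det_gram_ne_zero_iff_linearIndependent.2 b.linearIndependent).isUnit
  have hrepr : ∀ (Z : V) (i : ι),
      inner ℝ Z (b i) = Matrix.vecMul (b.repr Z) (Matrix.gram ℝ b) i := fun Z i => by
    conv_lhs => rw [← b.sum_repr Z]
    simp only [sum_inner, Matrix.vecMul, dotProduct, Matrix.gram_apply, real_inner_smul_left]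
  have hsum : ∀ i, ∑ j, (Matrix.gram ℝ b)⁻¹ i j * inner ℝ Y (b j) = b.repr Y i := fun i => by
    have h1 : ∀ j, inner ℝ Y (b j) = Matrix.mulVec (Matrix.gram ℝ b) (b.repr Y) j := fun j => by
      rw [hrepr, ← Matrix.mulVec_transpose]
      congr 2
      ext k l
      simp [Matrix.gram_apply, real_inner_comm]
    simp_rw [h1]
    change Matrix.mulVec _ (Matrix.mulVec _ _) i = _
    rw [Matrix.mulVec_mulVec, Matrix.nonsing_inv_mul _ hdet, Matrix.one_mulVec]
  calc inner ℝ X Y = ∑ i, inner ℝ X (b i) * b.repr Y i := by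
        conv_lhs => rw [← b.sum_repr Y]
        simp only [inner_sum, real_inner_smul_right, mul_comm]
    _ = _ := by
        refine Finset.sum_congr rfl fun i _ => ?_
        rw [← hsum i, Finset.mul_sum]
        exact Finset.sum_congr rfl fun j _ => by ring

variable {ι W : Type*} [Fintype ι] [AddCommGroup W] [Module ℝ W]

/-- If the bivector `∑ c i j s i ⊗ s j` is invariant under `J`, it is annihilated by every bilinear
form which is anti-invariant under `J`. -/
theorem sum_bilin_eq_zero_of_invariant [FiniteDimensional ℝ W] (c : Matrix ι ι ℝ) (s : ι → W)
    (J : W →ₗ[ℝ] W)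
    (h : ∀ a b : W →ₗ[ℝ] ℝ, ∑ i, ∑ j, c i j * (a (J (s i)) * b (J (s j)))
      = ∑ i, ∑ j, c i j * (a (s i) * b (s j)))
    (B : W →ₗ[ℝ] W →ₗ[ℝ] ℝ) (hB : ∀ u v, B (J u) (J v) = -B u v) :
    ∑ i, ∑ j, c i j * B (s i) (s j) = 0 := by
  set β := Module.finBasis ℝ W
  -- The hypothesis concerns products of functionals only; B is a finite sum of such products.
  have hexp : ∀ u v, B u v = ∑ k, β.coord k u * B (β k) v := fun u v => by
    conv_lhs => rw [← β.sum_repr u]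
    rw [map_sum, LinearMap.sum_apply]
    simp only [LinearMap.map_smul, LinearMap.smul_apply, smul_eq_mul, Module.Basis.coord_apply]
  have hswap : ∀ t : ι → W, ∑ i, ∑ j, c i j * B (t i) (t j)
      = ∑ k, ∑ i, ∑ j, c i j * (β.coord k (t i) * B (β k) (t j)) := fun t => by
    symm
    rw [Finset.sum_comm]
    refine Finset.sum_congr rfl fun i _ => ?_
    rw [Finset.sum_comm]
    refine Finset.sum_congr rfl fun j _ => ?_
    rw [hexp, Finset.mul_sum]
  have h1 : ∑ i, ∑ j, c i j * B (J (s i)) (J (s j)) = ∑ i, ∑ j, c i j * B (s i) (s j) := by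
    rw [hswap (fun i => J (s i)), hswap s]
    exact Finset.sum_congr rfl fun k _ => h (β.coord k) (B (β k))
  simp_rw [hB, mul_neg, Finset.sum_neg_distrib] at h1
  linarith

/-- The g^{ij}-sum of a and c is ⟨D D* u, v⟩ when u, v are the Riesz vectors of a, c. As J is skew,
composing both functionals with J replaces u, v by Ju, Jv, and for orthogonal J the equality of the
two values is commutation. -/
theorem invariant_iff_comp_adjoint_commute {ι V W : Type*} [Fintype ι] [DecidableEq ι]
    [NormedAddCommGroup V] [InnerProductSpace ℝ V] [FiniteDimensional ℝ V]
    [NormedAddCommGroup W] [InnerProductSpace ℝ W] [FiniteDimensional ℝ W]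
    (b : Module.Basis ι ℝ V) (D : V →ₗ[ℝ] W) (J : W →ₗ[ℝ] W) (hJ : ∀ u, J (J u) = -u)
    (hJ' : ∀ u v, inner ℝ (J u) (J v) = inner ℝ u v) :
    (D ∘ₗ LinearMap.adjoint D) ∘ₗ J = J ∘ₗ (D ∘ₗ LinearMap.adjoint D) ↔
      ∀ a c : W →ₗ[ℝ] ℝ,
        ∑ i, ∑ j, (Matrix.gram ℝ b)⁻¹ i j * (a (J (D (b i))) * c (J (D (b j))))
          = ∑ i, ∑ j, (Matrix.gram ℝ b)⁻¹ i j * (a (D (b i)) * c (D (b j))) := by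
  have hskew : ∀ u v, inner ℝ u (J v) = -inner ℝ (J u) v := fun u v => by
    rw [← hJ' u (J v), hJ, inner_neg_right]
  have hS : ∀ u v, inner ℝ (D (LinearMap.adjoint D u)) v
      = ∑ i, ∑ j, (Matrix.gram ℝ b)⁻¹ i j * (inner ℝ u (D (b i)) * inner ℝ v (D (b j))) :=
    fun u v => by
      rw [← LinearMap.adjoint_inner_right, inner_eq_sum_gram_inv b]
      simp_rw [LinearMap.adjoint_inner_left]
  have hSJ : ∀ u v, inner ℝ (D (LinearMap.adjoint D (J u))) (J v)
      = ∑ i, ∑ j, (Matrix.gram ℝ b)⁻¹ i j *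
        (inner ℝ u (J (D (b i))) * inner ℝ v (J (D (b j)))) := fun u v => by
    simp_rw [hS, hskew, neg_mul_neg]
  constructor
  · intro h a c
    obtain ⟨u, hu⟩ := (InnerProductSpace.toDual ℝ W).surjective (LinearMap.toContinuousLinearMap a)
    obtain ⟨v, hv⟩ := (InnerProductSpace.toDual ℝ W).surjective (LinearMap.toContinuousLinearMap c)
    have ha : ∀ w, a w = inner ℝ u w := fun w => by
      rw [← InnerProductSpace.toDual_apply_apply, hu]; rfl
    have hc : ∀ w, c w = inner ℝ v w := fun w => by
      rw [← InnerProductSpace.toDual_apply_apply, hv]; rfl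
    simp_rw [ha, hc]
    rw [← hS, ← hSJ]
    have := LinearMap.congr_fun h u
    simp only [LinearMap.comp_apply] at this
    rw [this, hJ']
  · intro h
    ext u
    simp only [LinearMap.comp_apply]
    refine ext_inner_right ℝ fun v => ?_
    have h1 := h (innerₗ W u) (innerₗ W (J v))
    simp only [innerₗ_apply_apply] at h1
    rw [← hS, ← hSJ, hJ, inner_neg_right, hskew] at h1
    exact neg_injective h1

end LinearAlgebra

/-! ### The metric in a chart -/

section ChartMetric

variable {E : Type*} [NormedAddCommGroup E] [NormedSpace ℝ E]
  {M : Type*} [TopologicalSpace M] [ChartedSpace E M]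

/-- The derivative of the inverse of the chart at `x₀` is the derivative of a transition map. -/
theorem mfderiv_extChartAt_symm_eq_fderiv [IsManifold 𝓘(ℝ, E) 1 M] (x₀ : M) {p : E}
    (hp : p ∈ (extChartAt 𝓘(ℝ, E) x₀).target) :
    (mfderiv 𝓘(ℝ, E) 𝓘(ℝ, E) (extChartAt 𝓘(ℝ, E) x₀).symm p : E →L[ℝ] E)
      = fderiv ℝ (extChartAt 𝓘(ℝ, E) ((extChartAt 𝓘(ℝ, E) x₀).symm p)
          ∘ (extChartAt 𝓘(ℝ, E) x₀).symm) p := by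
  have h : MDifferentiableAt 𝓘(ℝ, E) 𝓘(ℝ, E) (extChartAt 𝓘(ℝ, E) x₀).symm p :=
    ((contMDiffOn_extChartAt_symm (n := 1) x₀).contMDiffAt
      ((isOpen_extChartAt_target x₀).mem_nhds hp)).mdifferentiableAt one_ne_zero
  refine h.mfderiv.trans ?_
  simp only [mfld_simps, fderivWithin_univ]
  rfl

theorem mfderiv_extChartAt_symm_self [IsManifold 𝓘(ℝ, E) 1 M] (x : M) (u : E) :
    (mfderiv 𝓘(ℝ, E) 𝓘(ℝ, E) (extChartAt 𝓘(ℝ, E) x).symm (extChartAt 𝓘(ℝ, E) x x) u : E) = u := by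
  have h := mfderiv_extChartAt_symm_eq_fderiv x (mem_extChartAt_target (I := 𝓘(ℝ, E)) x)
  rw [extChartAt_to_inv] at h
  have h2 := fderivWithin_extChartAt_comp_extChartAt_symm_range (I := 𝓘(ℝ, E)) (x := x)
  rw [modelWithCornersSelf_coe, Set.range_id, fderivWithin_univ] at h2
  exact congrArg (fun T : E →L[ℝ] E => T u) (h.trans h2)

variable [RiemannianBundle (fun x : M => TangentSpace 𝓘(ℝ, E) x)]

theorem chartMetric_self [IsManifold 𝓘(ℝ, E) 1 M] (x : M) (u v : TangentSpace 𝓘(ℝ, E) x) :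
    chartMetric (E := E) x (extChartAt 𝓘(ℝ, E) x x) u v = inner ℝ u v := by
  -- The base point `(extChartAt 𝓘(ℝ, E) x).symm p` equals x only propositionally, so the two
  -- tangent spaces are distinct types until y is generalised.
  have key : ∀ y : M, y = x → ∀ a b : TangentSpace 𝓘(ℝ, E) y, (a : E) = u → (b : E) = v →
      inner ℝ a b = inner ℝ u v := by
    rintro y rfl a b rfl rfl
    rfl
  exact key _ (extChartAt_to_inv x) _ _ (mfderiv_extChartAt_symm_self (E := E) x u)
    (mfderiv_extChartAt_symm_self (E := E) x v)

theorem exists_bilin_eq_chartMetric (x₀ : M) (p : E) :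
    ∃ B : E →ₗ[ℝ] E →ₗ[ℝ] ℝ, ∀ u v, chartMetric x₀ p u v = B u v :=
  let T : E →ₗ[ℝ] TangentSpace 𝓘(ℝ, E) ((extChartAt 𝓘(ℝ, E) x₀).symm p) :=
    (mfderiv 𝓘(ℝ, E) 𝓘(ℝ, E) (extChartAt 𝓘(ℝ, E) x₀).symm p).toLinearMap
  ⟨(innerₗ (TangentSpace 𝓘(ℝ, E) ((extChartAt 𝓘(ℝ, E) x₀).symm p))).compl₁₂ T T, fun _ _ => rfl⟩

theorem chartMetric_comm (x₀ : M) (p u v : E) : chartMetric x₀ p u v = chartMetric x₀ p v u :=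
  real_inner_comm _ _

theorem chartMetric_add_left (x₀ : M) (p u u' v : E) :
    chartMetric x₀ p (u + u') v = chartMetric x₀ p u v + chartMetric x₀ p u' v := by
  obtain ⟨B, hB⟩ := exists_bilin_eq_chartMetric x₀ p
  simp only [hB, map_add, LinearMap.add_apply]

theorem chartMetric_smul_left (x₀ : M) (p : E) (c : ℝ) (u v : E) :
    chartMetric x₀ p (c • u) v = c * chartMetric x₀ p u v := by
  obtain ⟨B, hB⟩ := exists_bilin_eq_chartMetric x₀ p
  simp only [hB, LinearMap.map_smul, LinearMap.smul_apply, smul_eq_mul]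

theorem chartMetric_neg_left (x₀ : M) (p u v : E) :
    chartMetric x₀ p (-u) v = -chartMetric x₀ p u v := by
  simpa using chartMetric_smul_left x₀ p (-1) u v

variable [IsManifold 𝓘(ℝ, E) ∞ M]
  [IsContMDiffRiemannianBundle 𝓘(ℝ, E) ∞ E (fun x : M => TangentSpace 𝓘(ℝ, E) x)]

/-- The coordinate fields are C¹ sections along the inverse chart: they are its tangent map applied
to constant fields. Pairing them by a smooth metric keeps differentiability. -/
theorem differentiableAt_chartMetric
    (x₀ : M) {p : E} (hp : p ∈ (extChartAt 𝓘(ℝ, E) x₀).target) (u v : E) :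
    DifferentiableAt ℝ (fun q => chartMetric x₀ q u v) p := by
  have hsec : ∀ w : E, MDifferentiableAt 𝓘(ℝ, E) 𝓘(ℝ, E).tangent
      (fun q => (⟨(extChartAt 𝓘(ℝ, E) x₀).symm q,
        mfderiv 𝓘(ℝ, E) 𝓘(ℝ, E) (extChartAt 𝓘(ℝ, E) x₀).symm q w⟩ : TangentBundle 𝓘(ℝ, E) M))
      p := by
    intro w
    have hopen := isOpen_extChartAt_target (I := 𝓘(ℝ, E)) x₀
    have h1 := (contMDiffOn_extChartAt_symm (I := 𝓘(ℝ, E)) (n := 2) x₀)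
      |>.contMDiffOn_tangentMapWithin (m := 1) (by norm_num) hopen.uniqueMDiffOn
    have h2 : ContMDiff 𝓘(ℝ, E) 𝓘(ℝ, E).tangent 1
        (fun q : E => (⟨q, w⟩ : TangentBundle 𝓘(ℝ, E) E)) :=
      contMDiff_vectorSpace_iff_contDiff.2 contDiff_const
    have h3 : ContMDiffOn 𝓘(ℝ, E) 𝓘(ℝ, E).tangent 1 _ (extChartAt 𝓘(ℝ, E) x₀).target :=
      h1.comp h2.contMDiffOn fun q hq => hq
    refine ((h3.contMDiffAt (hopen.mem_nhds hp)).mdifferentiableAt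
      one_ne_zero).congr_of_eventuallyEq ?_
    filter_upwards [hopen.mem_nhds hp] with q hq
    simp only [Function.comp, tangentMapWithin]
    rw [mfderivWithin_of_isOpen hopen hq]
  have hinner : MDifferentiableAt 𝓘(ℝ, E) 𝓘(ℝ, ℝ) (fun q : E => inner ℝ
      (mfderiv 𝓘(ℝ, E) 𝓘(ℝ, E) (extChartAt 𝓘(ℝ, E) x₀).symm q u)
      (mfderiv 𝓘(ℝ, E) 𝓘(ℝ, E) (extChartAt 𝓘(ℝ, E) x₀).symm q v)) p := by
    apply MDifferentiableAt.inner_bundle (IB := 𝓘(ℝ, E)) (F := E)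
      (E := fun x : M => TangentSpace 𝓘(ℝ, E) x) (b := (extChartAt 𝓘(ℝ, E) x₀).symm)
    · exact hsec u
    · exact hsec v
  exact hinner.differentiableAt

theorem fderiv_chartMetric_add_left (x₀ : M) {p : E} (hp : p ∈ (extChartAt 𝓘(ℝ, E) x₀).target)
    (u u' v : E) : fderiv ℝ (fun q => chartMetric x₀ q (u + u') v) p
      = fderiv ℝ (fun q => chartMetric x₀ q u v) p
        + fderiv ℝ (fun q => chartMetric x₀ q u' v) p := by
  rw [← fderiv_fun_add (differentiableAt_chartMetric x₀ hp u v)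
    (differentiableAt_chartMetric x₀ hp u' v)]
  simp only [chartMetric_add_left]

theorem fderiv_chartMetric_smul_left (x₀ : M) {p : E} (hp : p ∈ (extChartAt 𝓘(ℝ, E) x₀).target)
    (c : ℝ) (u v : E) : fderiv ℝ (fun q => chartMetric x₀ q (c • u) v) p
      = c • fderiv ℝ (fun q => chartMetric x₀ q u v) p := by
  rw [← fderiv_fun_const_smul (differentiableAt_chartMetric x₀ hp u v)]
  simp only [chartMetric_smul_left, smul_eq_mul]

omit [IsManifold 𝓘(ℝ, E) ∞ M]
  [IsContMDiffRiemannianBundle 𝓘(ℝ, E) ∞ E (fun x : M => TangentSpace 𝓘(ℝ, E) x)] in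
theorem christoffel_comm [FiniteDimensional ℝ E] (x₀ : M) (p u v : E) :
    christoffel x₀ p u v = christoffel x₀ p v u := by
  simp only [christoffel]
  refine Finset.sum_congr rfl fun k _ => Finset.sum_congr rfl fun l _ => ?_
  simp only [chartMetric_comm x₀ _ u v]
  ring_nf

/-- The Christoffel symbols at a point of a chart, as a bilinear map. -/
noncomputable def christoffelBilin [FiniteDimensional ℝ E]
    (x₀ : M) (p : E) (hp : p ∈ (extChartAt 𝓘(ℝ, E) x₀).target) : E →ₗ[ℝ] E →ₗ[ℝ] E :=
  have hadd : ∀ u u' v,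
      christoffel x₀ p (u + u') v = christoffel x₀ p u v + christoffel x₀ p u' v := fun u u' v => by
    simp only [christoffel, ← Finset.sum_add_distrib, ← add_smul,
      fderiv_chartMetric_add_left x₀ hp, map_add, add_apply]
    refine Finset.sum_congr rfl fun k _ => Finset.sum_congr rfl fun l _ => ?_
    congr 1; ring
  have hsmul : ∀ (c : ℝ) u v,
      christoffel x₀ p (c • u) v = c • christoffel x₀ p u v := fun c u v => by
    simp only [christoffel, Finset.smul_sum, smul_smul, fderiv_chartMetric_smul_left x₀ hp,
      map_smul, smul_apply, smul_eq_mul]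
    refine Finset.sum_congr rfl fun k _ => Finset.sum_congr rfl fun l _ => ?_
    congr 1; ring
  LinearMap.mk₂ ℝ (christoffel x₀ p) hadd hsmul
    (fun u v v' => by simp only [christoffel_comm x₀ p u, hadd])
    (fun c u v => by simp only [christoffel_comm x₀ p u, hsmul])

@[simp]
theorem christoffelBilin_apply [FiniteDimensional ℝ E] (x₀ : M) (p : E)
    (hp : p ∈ (extChartAt 𝓘(ℝ, E) x₀).target) (u v : E) :
    christoffelBilin x₀ p hp u v = christoffel x₀ p u v := rfl

end ChartMetric

/-! ### Complex structure and Kähler metrics in holomorphic charts -/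

section KahlerChristoffel

variable {E' : Type*} [NormedAddCommGroup E'] [NormedSpace ℂ E']
  {N : Type*} [TopologicalSpace N] [ChartedSpace E' N] [IsManifold 𝓘(ℂ, E') ω N]

theorem contDiffAt_complex_coordChange (y y' : N) {p : E'}
    (hp : p ∈ (extChartAt 𝓘(ℝ, E') y').target)
    (hp' : (extChartAt 𝓘(ℝ, E') y').symm p ∈ (extChartAt 𝓘(ℝ, E') y).source) :
    ContDiffAt ℂ ω (extChartAt 𝓘(ℝ, E') y ∘ (extChartAt 𝓘(ℝ, E') y').symm) p := by
  have h := contDiffWithinAt_ext_coord_change (I := 𝓘(ℂ, E')) (n := ω) y y' (y := p)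
    ⟨hp, hp'⟩
  rw [modelWithCornersSelf_coe, Set.range_id, contDiffWithinAt_univ] at h
  exact h

/-- The derivative of the inverse chart is that of a holomorphic transition map, hence complex
linear. -/
theorem mfderiv_extChartAt_symm_I_smul (y : N) {p : E'}
    (hp : p ∈ (extChartAt 𝓘(ℝ, E') y).target) (u : E') :
    (mfderiv 𝓘(ℝ, E') 𝓘(ℝ, E') (extChartAt 𝓘(ℝ, E') y).symm p (Complex.I • u : E') : E')
      = almostComplexJ _ (mfderiv 𝓘(ℝ, E') 𝓘(ℝ, E') (extChartAt 𝓘(ℝ, E') y).symm p u) := by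
  have h := (contDiffAt_complex_coordChange _ y hp (mem_extChartAt_source (I := 𝓘(ℝ, E'))
    ((extChartAt 𝓘(ℝ, E') y).symm p))).differentiableAt (by simp)
  have h2 := (mfderiv_extChartAt_symm_eq_fderiv y hp).trans (h.fderiv_restrictScalars ℝ)
  have h3 : ∀ w : E', (mfderiv 𝓘(ℝ, E') 𝓘(ℝ, E') (extChartAt 𝓘(ℝ, E') y).symm p w : E') = _ :=
    fun w => congrArg (fun T : E' →L[ℝ] E' => T w) h2
  refine (h3 _).trans (Eq.trans ?_ (congrArg (fun w : E' => Complex.I • w) (h3 u).symm))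
  exact (fderiv ℂ (extChartAt 𝓘(ℝ, E') ((extChartAt 𝓘(ℝ, E') y).symm p)
    ∘ (extChartAt 𝓘(ℝ, E') y).symm) p).map_smul Complex.I u

variable [RiemannianBundle (fun y : N => TangentSpace 𝓘(ℝ, E') y)]

theorem chartKahlerForm_eq (y : N) {p : E'} (hp : p ∈ (extChartAt 𝓘(ℝ, E') y).target) (u v : E') :
    chartKahlerForm y p u v = chartMetric y p (Complex.I • u) v := by
  unfold chartKahlerForm chartMetric
  have h := mfderiv_extChartAt_symm_I_smul y hp u
  exact congrArg (fun w : TangentSpace 𝓘(ℝ, E') ((extChartAt 𝓘(ℝ, E') y).symm p) =>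
    inner ℝ w (mfderiv 𝓘(ℝ, E') 𝓘(ℝ, E') (extChartAt 𝓘(ℝ, E') y).symm p v)) h.symm

theorem IsKahlerMetric.chartMetric_I_smul (hN : IsKahlerMetric E' N) (y : N) {p : E'}
    (hp : p ∈ (extChartAt 𝓘(ℝ, E') y).target) (u v : E') :
    chartMetric y p (Complex.I • u) (Complex.I • v) = chartMetric y p u v := by
  have key : ∀ a b a' b' : TangentSpace 𝓘(ℝ, E') ((extChartAt 𝓘(ℝ, E') y).symm p),
      almostComplexJ _ a = a' → almostComplexJ _ b = b' → inner ℝ a' b' = inner ℝ a b := by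
    rintro a b _ _ rfl rfl
    exact hN.hermitian _ a b
  exact key _ _ _ _ (mfderiv_extChartAt_symm_I_smul y hp u).symm
    (mfderiv_extChartAt_symm_I_smul y hp v).symm

/-- The Christoffel symbols of a Kähler metric are of type `(2, 0)`. -/
theorem IsKahlerMetric.christoffel_I_smul [FiniteDimensional ℂ E'] (hN : IsKahlerMetric E' N)
    (y : N) (u v : E') :
    christoffel y (extChartAt 𝓘(ℝ, E') y y) (Complex.I • u) (Complex.I • v)
      = -christoffel y (extChartAt 𝓘(ℝ, E') y y) u v := by
  set p := extChartAt 𝓘(ℝ, E') y y with hp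
  have htarget : ∀ᶠ q in nhds p, q ∈ (extChartAt 𝓘(ℝ, E') y).target :=
    extChartAt_target_mem_nhds y
  have hinv : ∀ a b : E', fderiv ℝ (fun q => chartMetric y q (Complex.I • a) (Complex.I • b)) p
      = fderiv ℝ (fun q => chartMetric y q a b) p := fun a b =>
    Filter.EventuallyEq.fderiv_eq <| htarget.mono fun q hq => hN.chartMetric_I_smul y hq a b
  have hform : ∀ a b : E', fderiv ℝ (fun q => chartKahlerForm y q a b) p
      = fderiv ℝ (fun q => chartMetric y q (Complex.I • a) b) p := fun a b =>
    Filter.EventuallyEq.fderiv_eq <| htarget.mono fun q hq => chartKahlerForm_eq y hq a b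
  have hneg : ∀ a b : E', fderiv ℝ (fun q => chartMetric y q (Complex.I • Complex.I • a) b) p
      = -fderiv ℝ (fun q => chartMetric y q a b) p := fun a b => by
    simp only [smul_smul, Complex.I_mul_I, neg_smul, one_smul, chartMetric_neg_left, fderiv_fun_neg]
  -- This is dΩ(ia, b, w) = 0 with Ω(u, v) = g(iu, v) and i² = -1. Used for (u, v) and (v, u), it
  -- turns the first two terms of the Koszul expression at (iu, iv) into 2 ∂_w g(u, v) - ∂_v g(u, w)
  -- - ∂_u g(v, w); subtracting ∂_w g(iu, iv) = ∂_w g(u, v) leaves minus the expression at (u, v).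
  have hclosed : ∀ a b w : E', fderiv ℝ (fun q => chartMetric y q (Complex.I • b) w) p (Complex.I • a)
      = fderiv ℝ (fun q => chartMetric y q a b) p w
        - fderiv ℝ (fun q => chartMetric y q a w) p b := fun a b w => by
    have h := hN.closed y (Complex.I • a) b w
    rw [← hp, hform, hform, hform, hneg, hinv, neg_apply] at h
    simp only [chartMetric_comm y _ w a] at h
    linarith
  simp only [christoffel, ← Finset.sum_neg_distrib]
  refine Finset.sum_congr rfl fun k _ => Finset.sum_congr rfl fun l _ => ?_
  rw [← neg_smul, hclosed, hclosed, hinv]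
  simp only [chartMetric_comm y _ v u]
  congr 1
  ring

end KahlerChristoffel

/-! ### Second derivatives -/

section SecondDerivative

theorem ContDiffAt.eventually_differentiableAt {𝕜 E F : Type*} [NontriviallyNormedField 𝕜]
    [NormedAddCommGroup E] [NormedSpace 𝕜 E] [NormedAddCommGroup F] [NormedSpace 𝕜 F] {f : E → F}
    {p : E} (hf : ContDiffAt 𝕜 2 f p) : ∀ᶠ q in nhds p, DifferentiableAt 𝕜 f q :=
  (hf.eventually (by simp)).mono fun _ hq => hq.differentiableAt two_ne_zero

theorem ContDiffAt.differentiableAt_fderiv {𝕜 E F : Type*} [NontriviallyNormedField 𝕜]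
    [NormedAddCommGroup E] [NormedSpace 𝕜 E] [NormedAddCommGroup F] [NormedSpace 𝕜 F] {f : E → F}
    {p : E} (hf : ContDiffAt 𝕜 2 f p) : DifferentiableAt 𝕜 (fderiv 𝕜 f) p :=
  (hf.fderiv_right (m := 1) (by norm_num)).differentiableAt one_ne_zero

theorem fderiv_fderiv_comp {E F G : Type*} [NormedAddCommGroup E] [NormedSpace ℝ E]
    [NormedAddCommGroup F] [NormedSpace ℝ F] [NormedAddCommGroup G] [NormedSpace ℝ G]
    {g : F → G} {ψ : E → F} {p : E} (hg : ContDiffAt ℝ 2 g (ψ p)) (hψ : ContDiffAt ℝ 2 ψ p)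
    (u v : E) :
    fderiv ℝ (fderiv ℝ (g ∘ ψ)) p u v
      = fderiv ℝ (fderiv ℝ g) (ψ p) (fderiv ℝ ψ p u) (fderiv ℝ ψ p v)
        + fderiv ℝ g (ψ p) (fderiv ℝ (fderiv ℝ ψ) p u v) := by
  have h1 : fderiv ℝ (g ∘ ψ) =ᶠ[nhds p] fun q => (fderiv ℝ g (ψ q)).comp (fderiv ℝ ψ q) := by
    filter_upwards [hψ.continuousAt.eventually hg.eventually_differentiableAt,
      hψ.eventually_differentiableAt] with q h1 h2
    exact fderiv_comp q h1 h2
  have h2 : HasFDerivAt (fun q => fderiv ℝ g (ψ q))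
      ((fderiv ℝ (fderiv ℝ g) (ψ p)).comp (fderiv ℝ ψ p)) p :=
    hg.differentiableAt_fderiv.hasFDerivAt.comp p (hψ.differentiableAt two_ne_zero).hasFDerivAt
  rw [h1.fderiv_eq, (h2.clm_comp hψ.differentiableAt_fderiv.hasFDerivAt).fderiv]
  simp [add_comm]

variable {E' : Type*} [NormedAddCommGroup E'] [NormedSpace ℂ E']

theorem hasFDerivAt_re_comp {g : E' → ℂ} {p : E'} (hg : DifferentiableAt ℂ g p) :
    HasFDerivAt (fun q => (g q).re) (Complex.reCLM.comp ((fderiv ℂ g p).restrictScalars ℝ)) p :=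
  Complex.reCLM.hasFDerivAt.comp p (hg.hasFDerivAt.restrictScalars ℝ)

theorem fderiv_re_comp {g : E' → ℂ} {p : E'} (hg : DifferentiableAt ℂ g p) (u : E') :
    fderiv ℝ (fun q => (g q).re) p u = (fderiv ℂ g p u).re := by
  rw [(hasFDerivAt_re_comp hg).fderiv]
  rfl

theorem fderiv_fderiv_apply {E F : Type*} [NormedAddCommGroup E] [NormedSpace ℝ E]
    [NormedAddCommGroup F] [NormedSpace ℝ F] {g : E → F} {p : E} (hg : ContDiffAt ℝ 2 g p)
    (u v : E) : fderiv ℝ (fun q => fderiv ℝ g q v) p u = fderiv ℝ (fderiv ℝ g) p u v := by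
  rw [fderiv_clm_apply hg.differentiableAt_fderiv (differentiableAt_const v)]
  simp

theorem fderiv_fderiv_re_comp {g : E' → ℂ} {p : E'} (hg : ContDiffAt ℂ 2 g p) (u v : E') :
    fderiv ℝ (fderiv ℝ (fun q => (g q).re)) p u v = (fderiv ℂ (fderiv ℂ g) p u v).re := by
  have hre : ContDiffAt ℝ 2 (fun q => (g q).re) p :=
    Complex.reCLM.contDiff.contDiffAt.comp p (hg.restrict_scalars ℝ)
  have h1 : (fun q => fderiv ℝ (fun q => (g q).re) q v) =ᶠ[nhds p]
      fun q => (fderiv ℂ g q v).re := by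
    filter_upwards [hg.eventually_differentiableAt] with q hq
    exact fderiv_re_comp hq v
  rw [← fderiv_fderiv_apply hre, h1.fderiv_eq,
    fderiv_re_comp (hg.differentiableAt_fderiv.clm_apply (differentiableAt_const v)),
    fderiv_clm_apply hg.differentiableAt_fderiv (differentiableAt_const v)]
  simp

/-- The real part is, up to a constant, the J-invariant part of the real Hessian, so its vanishing
for all v, w is J-anti-invariance of the Hessian. -/
theorem wirtinger_wirtingerBar_ofReal {g : E' → ℝ} {p : E'} (hg : ContDiffAt ℝ 2 g p)
    (v w : E') :
    wirtinger (wirtingerBar (fun q => (g q : ℂ)) w) v p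
      = (1 / 4 : ℂ) * (((fderiv ℝ (fderiv ℝ g) p v w
          + fderiv ℝ (fderiv ℝ g) p (Complex.I • v) (Complex.I • w) : ℝ) : ℂ)
        + ((fderiv ℝ (fderiv ℝ g) p v (Complex.I • w)
          - fderiv ℝ (fderiv ℝ g) p (Complex.I • v) w : ℝ) : ℂ) * Complex.I) := by
  have h1 : wirtingerBar (fun q => (g q : ℂ)) w =ᶠ[nhds p] fun q =>
      (1 / 2 : ℂ) * ((fderiv ℝ g q w : ℂ) + Complex.I * (fderiv ℝ g q (Complex.I • w) : ℂ)) := by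
    filter_upwards [hg.eventually_differentiableAt] with q hq
    have h : fderiv ℝ (fun q => (g q : ℂ)) q = Complex.ofRealCLM.comp (fderiv ℝ g q) :=
      (Complex.ofRealCLM.hasFDerivAt.comp q hq.hasFDerivAt).fderiv
    simp [wirtingerBar, h]
  have h2 : ∀ a : E', HasFDerivAt (fun q => (fderiv ℝ g q a : ℂ))
      (Complex.ofRealCLM.comp (fderiv ℝ (fun q => fderiv ℝ g q a) p)) p := fun a =>
    Complex.ofRealCLM.hasFDerivAt.comp p
      (hg.differentiableAt_fderiv.clm_apply (differentiableAt_const a)).hasFDerivAt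
  have h3 := ((h2 w).add ((h2 (Complex.I • w)).const_mul Complex.I)).const_mul (1 / 2 : ℂ)
  have h4 : ∀ a : E', fderiv ℝ (wirtingerBar (fun q => (g q : ℂ)) w) p a
      = (1 / 2 : ℂ) * ((fderiv ℝ (fderiv ℝ g) p a w : ℂ)
        + Complex.I * (fderiv ℝ (fderiv ℝ g) p a (Complex.I • w) : ℂ)) := fun a => by
    rw [h1.fderiv_eq]
    refine (congrArg (fun T : E' →L[ℝ] ℂ => T a) h3.fderiv).trans ?_
    simp [fderiv_fderiv_apply hg, mul_add]
  simp only [wirtinger, h4]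
  push_cast
  linear_combination (-(1 / 4 : ℂ) * (fderiv ℝ (fderiv ℝ g) p (Complex.I • v) (Complex.I • w) : ℂ)) *
    Complex.I_sq

end SecondDerivative

/-! ### Pluriharmonic functions -/

section Pluriharmonic

variable {E' : Type*} [NormedAddCommGroup E'] [NormedSpace ℂ E']
  {N : Type*} [TopologicalSpace N] [ChartedSpace E' N] [IsManifold 𝓘(ℂ, E') ω N]

theorem ContMDiffAt.contDiffAt_comp_extChartAt_symm {E : Type*} [NormedAddCommGroup E]
    [NormedSpace ℝ E] {M : Type*} [TopologicalSpace M] [ChartedSpace E M] [IsManifold 𝓘(ℝ, E) ∞ M]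
    {f : M → ℝ} {x : M} (hf : ContMDiffAt 𝓘(ℝ, E) 𝓘(ℝ, ℝ) ∞ f x) :
    ContDiffAt ℝ ∞ (f ∘ (extChartAt 𝓘(ℝ, E) x).symm) (extChartAt 𝓘(ℝ, E) x x) := by
  rw [← contMDiffAt_iff_contDiffAt]
  refine ContMDiffAt.comp _ ?_ ((contMDiffOn_extChartAt_symm x).contMDiffAt
    (extChartAt_target_mem_nhds x))
  rwa [extChartAt_to_inv]

theorem IsPluriharmonicOn.fderiv_fderiv_I_smul {f : N → ℝ} {V : Set N}
    (hf : IsPluriharmonicOn E' f V) (hV : IsOpen V) {y : N} (hy : y ∈ V) (v w : E') :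
    fderiv ℝ (fderiv ℝ (f ∘ (extChartAt 𝓘(ℝ, E') y).symm)) (extChartAt 𝓘(ℝ, E') y y)
        (Complex.I • v) (Complex.I • w)
      = -fderiv ℝ (fderiv ℝ (f ∘ (extChartAt 𝓘(ℝ, E') y).symm)) (extChartAt 𝓘(ℝ, E') y y) v w := by
  have hsmooth := ((hf.contMDiffOn.contMDiffAt (hV.mem_nhds hy)).contDiffAt_comp_extChartAt_symm
    ).of_le (m := 2) ENat.LEInfty.out
  have h := hf.wirtinger_wirtingerBar_eq_zero y hy v w
  replace h := (wirtinger_wirtingerBar_ofReal hsmooth v w).symm.trans h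
  have hre := congrArg Complex.re ((mul_eq_zero.1 h).resolve_left (by norm_num))
  simp only [Complex.add_re, Complex.mul_I_re, Complex.ofReal_re, Complex.ofReal_im,
    Complex.zero_re, neg_zero, add_zero] at hre
  linarith

/-- The real part of a holomorphic function of the coordinates is pluriharmonic. -/
theorem isPluriharmonicOn_re_comp_extChartAt (y : N) {P : E' → ℂ} (hP : ContDiff ℂ ω P) :
    IsPluriharmonicOn E' (fun z : N => (P (extChartAt 𝓘(ℝ, E') y z)).re)
      (extChartAt 𝓘(ℝ, E') y).source where
  contMDiffOn := by
    have h : ContDiff ℝ ∞ fun z => (P z).re :=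
      Complex.reCLM.contDiff.comp ((hP.restrict_scalars ℝ).of_le le_top)
    rw [extChartAt_source]
    exact h.contMDiff.comp_contMDiffOn contMDiffOn_extChartAt
  wirtinger_wirtingerBar_eq_zero y' hy' v w := by
    have hg : ContDiffAt ℂ 2 (fun p => P ((extChartAt 𝓘(ℝ, E') y ∘ (extChartAt 𝓘(ℝ, E') y').symm) p))
        (extChartAt 𝓘(ℝ, E') y' y') :=
      (hP.contDiffAt.comp _ (contDiffAt_complex_coordChange y y' (mem_extChartAt_target y')
        (by rwa [extChartAt_to_inv]))).of_le le_top
    have hre : ContDiffAt ℝ 2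
        (fun p => (P ((extChartAt 𝓘(ℝ, E') y ∘ (extChartAt 𝓘(ℝ, E') y').symm) p)).re)
        (extChartAt 𝓘(ℝ, E') y' y') :=
      Complex.reCLM.contDiff.contDiffAt.comp _ (hg.restrict_scalars ℝ)
    refine (wirtinger_wirtingerBar_ofReal hre v w).trans ?_
    -- The real Hessian is the real part of a complex bilinear form, so moving i out of both
    -- arguments gives -1 and the terms cancel.
    simp only [fderiv_fderiv_re_comp hg, map_smul, smul_apply, smul_eq_mul, ← mul_assoc,
      Complex.I_mul_I, neg_one_mul, Complex.neg_re]
    simp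

end Pluriharmonic

/-! ### Composition with a map -/

section Composition

variable {E : Type*} [NormedAddCommGroup E] [NormedSpace ℝ E]
  {M : Type*} [TopologicalSpace M] [ChartedSpace E M] [IsManifold 𝓘(ℝ, E) ∞ M]
  {F : Type*} [NormedAddCommGroup F] [NormedSpace ℝ F]
  {N : Type*} [TopologicalSpace N] [ChartedSpace F N] [IsManifold 𝓘(ℝ, F) ∞ N]

/-- The expression of `φ` in the charts at `x` and `φ x`. -/
noncomputable def chartMap (E F : Type*) [NormedAddCommGroup E] [NormedSpace ℝ E]
    [NormedAddCommGroup F] [NormedSpace ℝ F] {M : Type*} [TopologicalSpace M] [ChartedSpace E M]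
    {N : Type*} [TopologicalSpace N] [ChartedSpace F N] (φ : M → N) (x : M) : E → F :=
  extChartAt 𝓘(ℝ, F) (φ x) ∘ φ ∘ (extChartAt 𝓘(ℝ, E) x).symm

omit [IsManifold 𝓘(ℝ, E) ∞ M] [IsManifold 𝓘(ℝ, F) ∞ N] in
theorem chartMap_extChartAt (φ : M → N) (x : M) :
    chartMap E F φ x (extChartAt 𝓘(ℝ, E) x x) = extChartAt 𝓘(ℝ, F) (φ x) (φ x) := by
  simp [chartMap]

omit [IsManifold 𝓘(ℝ, E) ∞ M] [IsManifold 𝓘(ℝ, F) ∞ N] in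
theorem ContMDiffAt.contDiffAt_chartMap {φ : M → N} {x : M}
    (hφ : ContMDiffAt 𝓘(ℝ, E) 𝓘(ℝ, F) ∞ φ x) :
    ContDiffAt ℝ ∞ (chartMap E F φ x) (extChartAt 𝓘(ℝ, E) x x) := by
  have h := (contMDiffAt_iff.1 hφ).2
  rwa [modelWithCornersSelf_coe, Set.range_id, contDiffWithinAt_univ] at h

omit [IsManifold 𝓘(ℝ, E) ∞ M] [IsManifold 𝓘(ℝ, F) ∞ N] in
theorem mfderiv_eq_fderiv_chartMap {φ : M → N} {x : M}
    (hφ : MDifferentiableAt 𝓘(ℝ, E) 𝓘(ℝ, F) φ x) :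
    (mfderiv 𝓘(ℝ, E) 𝓘(ℝ, F) φ x : E →L[ℝ] F)
      = fderiv ℝ (chartMap E F φ x) (extChartAt 𝓘(ℝ, E) x x) := by
  refine hφ.mfderiv.trans ?_
  rw [modelWithCornersSelf_coe, Set.range_id, fderivWithin_univ]
  rfl

variable [FiniteDimensional ℝ E] [FiniteDimensional ℝ F]
  [RiemannianBundle (fun x : M => TangentSpace 𝓘(ℝ, E) x)]
  [RiemannianBundle (fun y : N => TangentSpace 𝓘(ℝ, F) y)]

omit [IsManifold 𝓘(ℝ, E) ∞ M] in
/-- The composition formula `Δ(f ∘ φ) = df(τ(φ)) + trace (∇df)(dφ, dφ)`. -/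
theorem laplaceBeltrami_comp {φ : M → N} {x : M} (hφ : ContMDiffAt 𝓘(ℝ, E) 𝓘(ℝ, F) ∞ φ x)
    {f : N → ℝ} (hf : ContMDiffAt 𝓘(ℝ, F) 𝓘(ℝ, ℝ) ∞ f (φ x)) :
    let q : F := extChartAt 𝓘(ℝ, F) (φ x) (φ x)
    let G : F → ℝ := f ∘ (extChartAt 𝓘(ℝ, F) (φ x)).symm
    let s := fun i => fderiv ℝ (chartMap E F φ x) (extChartAt 𝓘(ℝ, E) x x) (Module.finBasis ℝ E i)
    laplaceBeltrami (E := E) (f ∘ φ) x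
      = fderiv ℝ G q (tensionField (E := E) (F := F) φ x)
        + ∑ i, ∑ j, chartMetricInv x (extChartAt 𝓘(ℝ, E) x x) i j *
          (fderiv ℝ (fderiv ℝ G) q (s i) (s j)
            - fderiv ℝ G q (christoffel (φ x) q (s i) (s j))) := by
  intro q G s
  have hψ : ContDiffAt ℝ 2 (chartMap E F φ x) (extChartAt 𝓘(ℝ, E) x x) :=
    hφ.contDiffAt_chartMap.of_le ENat.LEInfty.out
  have hG : ContDiffAt ℝ 2 G (chartMap E F φ x (extChartAt 𝓘(ℝ, E) x x)) := by
    rw [chartMap_extChartAt]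
    exact hf.contDiffAt_comp_extChartAt_symm.of_le ENat.LEInfty.out
  have hcomp : (f ∘ φ) ∘ (extChartAt 𝓘(ℝ, E) x).symm
      =ᶠ[nhds (extChartAt 𝓘(ℝ, E) x x)] G ∘ chartMap E F φ x := by
    have hcont : ContinuousAt (φ ∘ (extChartAt 𝓘(ℝ, E) x).symm) (extChartAt 𝓘(ℝ, E) x x) :=
      ContinuousAt.comp (by simpa using hφ.continuousAt) (continuousAt_extChartAt_symm x)
    have hmem : (extChartAt 𝓘(ℝ, F) (φ x)).source
        ∈ nhds ((φ ∘ (extChartAt 𝓘(ℝ, E) x).symm) (extChartAt 𝓘(ℝ, E) x x)) := by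
      simpa using extChartAt_source_mem_nhds (I := 𝓘(ℝ, F)) (φ x)
    filter_upwards [hcont hmem] with z hz
    exact congrArg f ((extChartAt 𝓘(ℝ, F) (φ x)).left_inv hz).symm
  have h1 : ∀ v, fderiv ℝ (G ∘ chartMap E F φ x) (extChartAt 𝓘(ℝ, E) x x) v
      = fderiv ℝ G q (fderiv ℝ (chartMap E F φ x) (extChartAt 𝓘(ℝ, E) x x) v) := fun v => by
    rw [fderiv_comp _ (hG.differentiableAt two_ne_zero) (hψ.differentiableAt two_ne_zero),
      chartMap_extChartAt]
    rfl
  have h2 : tensionField (E := E) (F := F) φ x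
      = ∑ i, ∑ j, chartMetricInv x (extChartAt 𝓘(ℝ, E) x x) i j •
        (fderiv ℝ (fderiv ℝ (chartMap E F φ x)) (extChartAt 𝓘(ℝ, E) x x)
            (Module.finBasis ℝ E i) (Module.finBasis ℝ E j)
          - fderiv ℝ (chartMap E F φ x) (extChartAt 𝓘(ℝ, E) x x)
            (christoffel x (extChartAt 𝓘(ℝ, E) x x) (Module.finBasis ℝ E i) (Module.finBasis ℝ E j))
          + christoffel (φ x) q (s i) (s j)) := rfl
  rw [h2]
  simp only [laplaceBeltrami, hcomp.fderiv_eq, hcomp.fderiv.fderiv_eq, h1,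
    fderiv_fderiv_comp hG hψ, chartMap_extChartAt, map_sum, map_smul, map_add, map_sub,
    smul_eq_mul, ← Finset.sum_add_distrib]
  -- The Christoffel term of N enters with a plus sign through the tension field and a minus sign
  -- through the covariant Hessian, and cancels.
  refine Finset.sum_congr rfl fun i _ => Finset.sum_congr rfl fun j _ => ?_
  simp only [s, q]
  ring

end Composition

/-! ### Invariance of the bivector and the test functions -/

section PseudoHarmonicMorphism

/-- Replacing α by iα turns imaginary parts into real ones, up to sign; the dual separates points.
-/
theorem eq_zero_of_forall_re_eq_zero {E' : Type*} [NormedAddCommGroup E'] [NormedSpace ℂ E']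
    {t : E'} (h : ∀ α : E' →L[ℂ] ℂ, (α t).re = 0) : t = 0 := by
  refine SeparatingDual.eq_zero_of_forall_dual_eq_zero (R := ℂ) fun α => Complex.ext (h α) ?_
  simpa using h (Complex.I • α)

variable {E : Type*} [NormedAddCommGroup E] [NormedSpace ℝ E] [FiniteDimensional ℝ E]
  {M : Type*} [TopologicalSpace M] [ChartedSpace E M] [IsManifold 𝓘(ℝ, E) ∞ M]
  [RiemannianBundle (fun x : M => TangentSpace 𝓘(ℝ, E) x)]
  {E' : Type*} [NormedAddCommGroup E'] [NormedSpace ℂ E']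
  {N : Type*} [TopologicalSpace N] [ChartedSpace E' N]

theorem chartMetricInv_self (x : M) :
    chartMetricInv x (extChartAt 𝓘(ℝ, E) x x)
      = (Matrix.gram ℝ (E := TangentSpace 𝓘(ℝ, E) x) (Module.finBasis ℝ E))⁻¹ := by
  unfold chartMetricInv
  congr 1
  ext i j
  exact chartMetric_self (E := E) x _ _

omit [IsManifold 𝓘(ℝ, E) ∞ M] in
theorem chartMetricInv_comm (x : M) (p : E) (i j) :
    chartMetricInv x p i j = chartMetricInv x p j i := by
  have h : (Matrix.of fun i j =>
      chartMetric x p (Module.finBasis ℝ E i) (Module.finBasis ℝ E j)).IsSymm :=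
    Matrix.IsSymm.ext fun _ _ => chartMetric_comm _ _ _ _
  exact (Matrix.IsSymm.inv h).apply j i

/-- The bivector `∑ g^{ij} ∂ᵢφ ⊗ ∂ⱼφ` at `φ x` is invariant under the complex structure. -/
def IsBivectorInvariantAt (E E' : Type*) [NormedAddCommGroup E] [NormedSpace ℝ E]
    [FiniteDimensional ℝ E] {M : Type*} [TopologicalSpace M] [ChartedSpace E M]
    [RiemannianBundle (fun x : M => TangentSpace 𝓘(ℝ, E) x)]
    [NormedAddCommGroup E'] [NormedSpace ℂ E'] {N : Type*} [TopologicalSpace N] [ChartedSpace E' N]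
    (φ : M → N) (x : M) : Prop :=
  let s := fun i => fderiv ℝ (chartMap E E' φ x) (extChartAt 𝓘(ℝ, E) x x) (Module.finBasis ℝ E i)
  ∀ a b : E' →ₗ[ℝ] ℝ,
    ∑ i, ∑ j, chartMetricInv x (extChartAt 𝓘(ℝ, E) x x) i j *
        (a (Complex.I • s i) * b (Complex.I • s j))
      = ∑ i, ∑ j, chartMetricInv x (extChartAt 𝓘(ℝ, E) x x) i j * (a (s i) * b (s j))

variable [FiniteDimensional ℂ E'] [IsManifold 𝓘(ℂ, E') ω N]
  [RiemannianBundle (fun y : N => TangentSpace 𝓘(ℝ, E') y)]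

omit [IsManifold 𝓘(ℂ, E') ω N] in
theorem isPHWC_iff (hN : IsKahlerMetric E' N) {φ : M → N} (hφ : ContMDiff 𝓘(ℝ, E) 𝓘(ℝ, E') ∞ φ) :
    IsPHWC E E' φ ↔ ∀ x, IsBivectorInvariantAt E E' φ x := by
  refine forall_congr' fun x => ?_
  have hd := mfderiv_eq_fderiv_chartMap ((hφ x).mdifferentiableAt (by simp))
  refine (invariant_iff_comp_adjoint_commute (V := TangentSpace 𝓘(ℝ, E) x)
    (W := TangentSpace 𝓘(ℝ, E') (φ x)) (Module.finBasis ℝ E)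
    (mfderiv 𝓘(ℝ, E) 𝓘(ℝ, E') φ x).toLinearMap (almostComplexJ (φ x)) (fun u => ?_)
    (hN.hermitian _)).trans ?_
  · change Complex.I • Complex.I • (show E' from u) = -(show E' from u)
    rw [smul_smul, Complex.I_mul_I, neg_one_smul]
  · unfold IsBivectorInvariantAt
    rw [← hd, chartMetricInv_self]
    rfl

variable [IsContMDiffRiemannianBundle 𝓘(ℝ, E') ∞ E' (fun y : N => TangentSpace 𝓘(ℝ, E') y)]

omit [IsManifold 𝓘(ℝ, E) ∞ M] in
-- Both parts of ∇df, the coordinate Hessian and the Christoffel term, are J-anti-invariant, so the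
-- trace against the invariant bivector vanishes.
theorem laplaceBeltrami_comp_of_isBivectorInvariantAt (hN : IsKahlerMetric E' N) {φ : M → N}
    (hφ : ContMDiff 𝓘(ℝ, E) 𝓘(ℝ, E') ∞ φ) {x : M} (hx : IsBivectorInvariantAt E E' φ x)
    {f : N → ℝ} {V : Set N} (hV : IsOpen V) (hf : IsPluriharmonicOn E' f V) (hxV : φ x ∈ V) :
    laplaceBeltrami (E := E) (f ∘ φ) x
      = fderiv ℝ (f ∘ (extChartAt 𝓘(ℝ, E') (φ x)).symm) (extChartAt 𝓘(ℝ, E') (φ x) (φ x))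
        (tensionField (E := E) (F := E') φ x) := by
  rw [laplaceBeltrami_comp (hφ x) (hf.contMDiffOn.contMDiffAt (hV.mem_nhds hxV)), add_eq_left]
  set q := extChartAt 𝓘(ℝ, E') (φ x) (φ x) with hq
  set G := f ∘ (extChartAt 𝓘(ℝ, E') (φ x)).symm with hG
  refine sum_bilin_eq_zero_of_invariant _ _
    ((LinearMap.lsmul ℂ E' Complex.I).restrictScalars ℝ) hx
    ((ContinuousLinearMap.coeLM ℝ).comp (fderiv ℝ (fderiv ℝ G) q).toLinearMap
      - (christoffelBilin (φ x) q (mem_extChartAt_target _)).compr₂ (fderiv ℝ G q).toLinearMap)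
    fun u v => ?_
  have h1 := hf.fderiv_fderiv_I_smul hV hxV u v
  have h2 := hN.christoffel_I_smul (φ x) u v
  rw [← hq, ← hG] at h1
  rw [← hq] at h2
  simp [h1, h2]
  ring

omit [FiniteDimensional ℂ E'] [IsManifold 𝓘(ℂ, E') ω N]
  [RiemannianBundle (fun y : N => TangentSpace 𝓘(ℝ, E') y)]
  [IsContMDiffRiemannianBundle 𝓘(ℝ, E') ∞ E' (fun y : N => TangentSpace 𝓘(ℝ, E') y)] in
theorem re_comp_extChartAt_comp_symm (y : N) (P : E' → ℂ) :
    (fun z : N => (P (extChartAt 𝓘(ℝ, E') y z)).re) ∘ (extChartAt 𝓘(ℝ, E') y).symm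
      =ᶠ[nhds (extChartAt 𝓘(ℝ, E') y y)] fun p => (P p).re := by
  filter_upwards [extChartAt_target_mem_nhds (I := 𝓘(ℝ, E')) y] with p hp
  simp only [Function.comp, (extChartAt 𝓘(ℝ, E') y).right_inv hp]

omit [IsManifold 𝓘(ℝ, E) ∞ M]
  [IsContMDiffRiemannianBundle 𝓘(ℝ, E') ∞ E' (fun y : N => TangentSpace 𝓘(ℝ, E') y)] in
-- The test function is Re(αβ), with α, β complex-linear in z - q. Its Hessian at q is the
-- symmetrisation of a ⊗ b - (a ∘ i) ⊗ (b ∘ i), so a zero trace is the required identity.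
theorem isBivectorInvariantAt_of_laplaceBeltrami_eq_zero {φ : M → N}
    (hφ : ContMDiff 𝓘(ℝ, E) 𝓘(ℝ, E') ∞ φ) (x : M)
    (h : ∀ V : Set N, IsOpen V → ∀ f : N → ℝ, IsPluriharmonicOn E' f V → φ x ∈ V →
      laplaceBeltrami (E := E) (f ∘ φ) x = 0) : IsBivectorInvariantAt E E' φ x := by
  intro a b
  set s := fun i =>
    fderiv ℝ (chartMap E E' φ x) (extChartAt 𝓘(ℝ, E) x x) (Module.finBasis ℝ E i)
  set q := extChartAt 𝓘(ℝ, E') (φ x) (φ x) with hq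
  set c := chartMetricInv x (extChartAt 𝓘(ℝ, E) x x) with hc
  -- The complex-linear functional with real part a is u ↦ a(u) - i a(iu).
  let α : E' →L[ℂ] ℂ := StrongDual.extendRCLike (LinearMap.toContinuousLinearMap a)
  let β : E' →L[ℂ] ℂ := StrongDual.extendRCLike (LinearMap.toContinuousLinearMap b)
  let P : E' → ℂ := fun z => α (z - q) * β (z - q)
  have hP : ContDiff ℂ ω P :=
    (α.contDiff.comp (contDiff_id.sub contDiff_const)).mul
      (β.contDiff.comp (contDiff_id.sub contDiff_const))
  have hf := isPluriharmonicOn_re_comp_extChartAt (φ x) hP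
  have hsource := isOpen_extChartAt_source (I := 𝓘(ℝ, E')) (φ x)
  have hmem := mem_extChartAt_source (I := 𝓘(ℝ, E')) (φ x)
  have h0 := h _ hsource _ hf hmem
  set G := (fun z : N => (P (extChartAt 𝓘(ℝ, E') (φ x) z)).re) ∘ (extChartAt 𝓘(ℝ, E') (φ x)).symm
  have hG : G =ᶠ[nhds q] fun p => (P p).re := re_comp_extChartAt_comp_symm (φ x) P
  -- The tension field may be any vector t: dG vanishes at q.
  obtain ⟨t, ht⟩ : ∃ t : E', fderiv ℝ G q t + ∑ i, ∑ j, c i j *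
      (fderiv ℝ (fderiv ℝ G) q (s i) (s j)
        - fderiv ℝ G q (christoffel (φ x) q (s i) (s j))) = 0 :=
    ⟨_, (laplaceBeltrami_comp (hφ x)
      (hf.contMDiffOn.contMDiffAt (hsource.mem_nhds hmem))).symm.trans h0⟩
  have hlin : ∀ (γ : E' →L[ℂ] ℂ) (z : E'), HasFDerivAt (fun z => γ (z - q)) γ z := fun γ z =>
    γ.hasFDerivAt.comp z ((hasFDerivAt_id z).sub_const q)
  have hd : fderiv ℂ P = fun z => α (z - q) • β + β (z - q) • α :=
    funext fun z => ((hlin α z).mul (hlin β z)).fderiv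
  have hd1 : ∀ u, fderiv ℂ P q u = 0 := fun u => by simp [hd]
  have hd2 : ∀ u v, fderiv ℂ (fderiv ℂ P) q u v = α u * β v + β u * α v := fun u v => by
    rw [hd, (((hlin α q).smul_const β).fun_add ((hlin β q).smul_const α)).fderiv]
    simp
  simp only [hG.fderiv_eq, hG.fderiv.fderiv_eq, hd1, hd2,
    fderiv_re_comp (hP.contDiffAt.differentiableAt (by simp)),
    fderiv_fderiv_re_comp (hP.contDiffAt.of_le le_top), Complex.zero_re, zero_add, sub_zero] at ht
  have hαre : ∀ u, (α u).re = a u :=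
    StrongDual.re_extendRCLike_apply (𝕜 := ℂ) (LinearMap.toContinuousLinearMap a)
  have hβre : ∀ u, (β u).re = b u :=
    StrongDual.re_extendRCLike_apply (𝕜 := ℂ) (LinearMap.toContinuousLinearMap b)
  have hIm : ∀ (γ : E' →L[ℂ] ℂ) u, (γ u).im = -(γ (Complex.I • u)).re := fun γ u => by simp
  have hre : ∀ u v, (α u * β v + β u * α v).re
      = (a u * b v - a (Complex.I • u) * b (Complex.I • v))
        + (a v * b u - a (Complex.I • v) * b (Complex.I • u)) := fun u v => by
    simp only [Complex.add_re, Complex.mul_re, hIm, hαre, hβre]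
    ring
  -- By symmetry of g^{ij} both halves of the symmetrised Hessian have the same trace, so `ht` is
  -- twice the wanted difference.
  have hsymm : ∑ i, ∑ j, c i j * (a (s j) * b (s i) - a (Complex.I • s j) * b (Complex.I • s i))
      = ∑ i, ∑ j, c i j * (a (s i) * b (s j) - a (Complex.I • s i) * b (Complex.I • s j)) := by
    rw [Finset.sum_comm]
    refine Finset.sum_congr rfl fun i _ => Finset.sum_congr rfl fun j _ => ?_
    rw [hc, chartMetricInv_comm x _ j i]
  simp only [hre, mul_add, Finset.sum_add_distrib, hsymm] at ht
  simp only [mul_sub, Finset.sum_sub_distrib] at ht ⊢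
  linarith

omit [IsManifold 𝓘(ℝ, E) ∞ M] in
-- With invariance known, Δ(f ∘ φ) = df(τ(φ)), and for f = Re α in the chart this is Re α(τ(φ)).
theorem tensionField_eq_zero_of_laplaceBeltrami_eq_zero (hN : IsKahlerMetric E' N) {φ : M → N}
    (hφ : ContMDiff 𝓘(ℝ, E) 𝓘(ℝ, E') ∞ φ) (x : M)
    (h : ∀ V : Set N, IsOpen V → ∀ f : N → ℝ, IsPluriharmonicOn E' f V → φ x ∈ V →
      laplaceBeltrami (E := E) (f ∘ φ) x = 0) : tensionField (E := E) (F := E') φ x = 0 := by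
  have hinv := isBivectorInvariantAt_of_laplaceBeltrami_eq_zero hφ x h
  refine eq_zero_of_forall_re_eq_zero (E' := E') fun α => ?_
  have hf := isPluriharmonicOn_re_comp_extChartAt (φ x) α.contDiff
  have hsource := isOpen_extChartAt_source (I := 𝓘(ℝ, E')) (φ x)
  have hmem := mem_extChartAt_source (I := 𝓘(ℝ, E')) (φ x)
  have h0 := h _ hsource _ hf hmem
  rw [laplaceBeltrami_comp_of_isBivectorInvariantAt hN hφ hinv hsource hf hmem,
    (re_comp_extChartAt_comp_symm (φ x) α).fderiv_eq] at h0
  replace h0 := (fderiv_re_comp α.differentiableAt _).symm.trans h0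
  rwa [α.fderiv] at h0

end PseudoHarmonicMorphism

theorem propositionV6
    {E : Type*} [NormedAddCommGroup E] [NormedSpace ℝ E] [FiniteDimensional ℝ E]
    {M : Type*} [TopologicalSpace M] [ChartedSpace E M] [IsManifold 𝓘(ℝ, E) ∞ M]
    [RiemannianBundle (fun x : M => TangentSpace 𝓘(ℝ, E) x)]
    [IsContMDiffRiemannianBundle 𝓘(ℝ, E) ∞ E (fun x : M => TangentSpace 𝓘(ℝ, E) x)]
    {E' : Type*} [NormedAddCommGroup E'] [NormedSpace ℂ E'] [FiniteDimensional ℂ E']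
    {N : Type*} [TopologicalSpace N] [ChartedSpace E' N] [IsManifold 𝓘(ℂ, E') ω N]
    [RiemannianBundle (fun y : N => TangentSpace 𝓘(ℝ, E') y)]
    [IsContMDiffRiemannianBundle 𝓘(ℝ, E') ∞ E' (fun y : N => TangentSpace 𝓘(ℝ, E') y)]
    (hN : IsKahlerMetric E' N)
    (φ : M → N) (hφ : ContMDiff 𝓘(ℝ, E) 𝓘(ℝ, E') ∞ φ) :
    (∀ (V : Set N), IsOpen V → ∀ f : N → ℝ, IsPluriharmonicOn E' f V →
        IsHarmonicFunctionOn E (f ∘ φ) (φ ⁻¹' V)) ↔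
      IsPseudoHarmonicMorphism E E' φ := by
  refine ⟨fun h => ?_, fun h V hV f hf => ?_⟩
  · have h' : ∀ x (V : Set N), IsOpen V → ∀ f : N → ℝ, IsPluriharmonicOn E' f V → φ x ∈ V →
        laplaceBeltrami (E := E) (f ∘ φ) x = 0 := fun x V hV f hf hx =>
      (h V hV f hf).laplaceBeltrami_eq_zero x hx
    exact ⟨⟨hφ, fun x => tensionField_eq_zero_of_laplaceBeltrami_eq_zero hN hφ x (h' x)⟩,
      (isPHWC_iff hN hφ).2 fun x =>
        isBivectorInvariantAt_of_laplaceBeltrami_eq_zero hφ x (h' x)⟩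
  · refine ⟨hf.contMDiffOn.comp hφ.contMDiffOn subset_rfl, fun x hx => ?_⟩
    rw [laplaceBeltrami_comp_of_isBivectorInvariantAt hN hφ ((isPHWC_iff hN hφ).1 h.isPHWC x)
      hV hf hx, h.isHarmonicMap.tensionField_eq_zero x]
    exact map_zero _
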